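/- Let $0<s<1\le w$ be real numbers, let $X\subseteq\mathbb{R}\times[s,w-s]\subseteq\mathbb{R}^2$ be $s$-separated (that is, $\|x-x'\|_2\ge s$ for all distinct $x,x'\in X$), and let $Y\subseteq X$. Then there exists a mapping $\gamma=(\gamma_1,\gamma_2)\colon\mathbb{R}\to\mathbb{R}^2$ which is $\frac{2^{30}w^4}{s^4}$-bilipschitz, that is, with $L=\frac{2^{30}w^4}{s^4}$, $$\tfrac1L|t-t'|\le\|\gamma(t)-\gamma(t')\|_2\le L|t-t'|\qquad\text{for all }t,t'\in\mathbb{R},$$ such that the following statements hold: (i) $|\gamma_1(t)-t|\le\frac{24s}{100}$ and $0\le\gamma_2(t)\le w$ for all $t\in\mathbb{R}$. (ii) $\|x-\gamma(t)\|_2\ge\frac{2s}{100}$ for all $t\in\mathbb{R}$ and $x\in X$. (iii) The half-planes $\mathbb{R}\times(w,\infty)$ and $\mathbb{R}\times(-\infty,0)$ lie in two different connected components $W_+$ and $W_-$, respectively, of $\mathbb{R}^2\setminus\gamma(\mathbb{R})$, and $Y\subseteq W_-$ and $X\setminus Y\subseteq W_+$. -/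

import Mathlib

/-- A map is `L`-bilipschitz: it is `L`-Lipschitz, injective, and its inverse is `L`-Lipschitz
(injectivity is forced by the second inequality). -/
def IsBilipschitz {α β : Type*} [MetricSpace α] [MetricSpace β] (L : ℝ) (f : α → β) : Prop :=
  ∀ x y : α, dist (f x) (f y) ≤ L * dist x y ∧ dist x y ≤ L * dist (f x) (f y)

/-- A set is `r`-separated: distinct points are at distance at least `r` (not strictly more). -/
def IsSeparatedBy {α : Type*} [MetricSpace α] (r : ℝ) (A : Set α) : Prop :=
  ∀ a ∈ A, ∀ b ∈ A, a ≠ b → r ≤ dist a b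

/-- `C` is a connected component of the subset `F` of a topological space. -/
def IsComponentOf {α : Type*} [TopologicalSpace α] (C F : Set α) : Prop :=
  ∃ x ∈ F, C = connectedComponentIn F x

open Set Real
open scoped NNReal

/-! Take the graph of a cosine wave clipped to `[0, w]`, with wavelength a small multiple of `s`.
Every point of the plane has a crest and a trough within half a wavelength horizontally. By
separation, moving `Y` to crests and `X \ Y` to troughs is a contractive displacement on `X`; it
extends to the plane (`exists_lipschitz_displacement`), and the resulting height-preserving shear is
a bilipschitz homeomorphism (`exists_homeomorph_horizontalShear`). The curve is the shear-preimage
of the graph: points of `Y` lie under a crest, the others over a trough, and the two complementary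
components are the preimages of the strict hypograph and epigraph. -/

/-- Two disjoint open preconnected sets are the components of their union. -/
theorem connectedComponentIn_eq_of_isOpen_disjoint {α : Type*} [TopologicalSpace α]
    {F U V : Set α} (hF : F = U ∪ V) (hU : IsOpen U) (hV : IsOpen V) (hUV : Disjoint U V)
    (hUc : IsPreconnected U) {x : α} (hx : x ∈ U) : connectedComponentIn F x = U := by
  have hxF : x ∈ F := hF ▸ Or.inl hx
  refine Subset.antisymm ?_ (hUc.subset_connectedComponentIn hx (hF ▸ subset_union_left))
  exact IsPreconnected.subset_left_of_subset_union hU hV hUV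
    (hF ▸ connectedComponentIn_subset F x) ⟨x, mem_connectedComponentIn hxF, hx⟩
    isPreconnected_connectedComponentIn

theorem abs_apply_sub_le_dist (p q : EuclideanSpace ℝ (Fin 2)) (i : Fin 2) :
    |p i - q i| ≤ dist p q := by
  simpa [dist_eq_norm] using PiLp.norm_apply_le (p - q) i

theorem dist_le_abs_add_abs (p q : EuclideanSpace ℝ (Fin 2)) :
    dist p q ≤ |p 0 - q 0| + |p 1 - q 1| := by
  rw [EuclideanSpace.dist_eq, Fin.sum_univ_two, Real.dist_eq, Real.dist_eq]
  apply Real.sqrt_le_iff.2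
  refine ⟨by positivity, ?_⟩
  nlinarith [mul_nonneg (abs_nonneg (p 0 - q 0)) (abs_nonneg (p 1 - q 1))]

/-- The strict epigraph of a continuous function on the line is preconnected. -/
theorem isPreconnected_epigraph {f : ℝ → ℝ} (hf : Continuous f) :
    IsPreconnected {p : EuclideanSpace ℝ (Fin 2) | f (p 0) < p 1} := by
  have h : {p : EuclideanSpace ℝ (Fin 2) | f (p 0) < p 1} =
      (fun z : ℝ × ℝ ↦ !₂[z.1, f z.1 + z.2]) '' (univ ×ˢ Ioi 0) := by
    ext p
    simp only [mem_ofPred_eq, mem_image, mem_prod, mem_univ, true_and, mem_Ioi, Prod.exists]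
    constructor
    · intro hp
      refine ⟨p 0, p 1 - f (p 0), by linarith, ?_⟩
      ext i
      fin_cases i <;> simp
    · rintro ⟨a, b, hb, rfl⟩
      simpa using hb
  rw [h]
  refine (isPreconnected_univ.prod isPreconnected_Ioi).image _ (Continuous.continuousOn ?_)
  refine (PiLp.continuous_toLp 2 _).comp (continuous_pi fun i ↦ ?_)
  fin_cases i <;> simp <;> fun_prop

/-- The strict hypograph of a continuous function on the line is preconnected. -/
theorem isPreconnected_hypograph {f : ℝ → ℝ} (hf : Continuous f) :
    IsPreconnected {p : EuclideanSpace ℝ (Fin 2) | p 1 < f (p 0)} := by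
  have h : {p : EuclideanSpace ℝ (Fin 2) | p 1 < f (p 0)} =
      Neg.neg '' {p : EuclideanSpace ℝ (Fin 2) | -f (-p 0) < p 1} := by
    ext p
    simp
  rw [h]
  exact (isPreconnected_epigraph (f := fun x ↦ -f (-x)) (by fun_prop)).image _
    continuous_neg.continuousOn

/-- The horizontal shear `p ↦ p + g p • e₀`. -/
noncomputable def horizontalShear (g : EuclideanSpace ℝ (Fin 2) → ℝ)
    (p : EuclideanSpace ℝ (Fin 2)) : EuclideanSpace ℝ (Fin 2) :=
  p + EuclideanSpace.single 0 (g p)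

section HorizontalShear

variable {g : EuclideanSpace ℝ (Fin 2) → ℝ} {K : ℝ≥0}

@[simp] theorem horizontalShear_apply_zero (p : EuclideanSpace ℝ (Fin 2)) :
    horizontalShear g p 0 = p 0 + g p := by
  simp [horizontalShear]

@[simp] theorem horizontalShear_apply_one (p : EuclideanSpace ℝ (Fin 2)) :
    horizontalShear g p 1 = p 1 := by
  simp [horizontalShear]

theorem norm_horizontalShear_sub_sub_le (hg : LipschitzWith K g)
    (p q : EuclideanSpace ℝ (Fin 2)) :
    ‖horizontalShear g p - horizontalShear g q - (p - q)‖ ≤ K * ‖p - q‖ := by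
  have h : horizontalShear g p - horizontalShear g q - (p - q) =
      EuclideanSpace.single 0 (g p - g q) := by
    ext i
    fin_cases i <;> simp; ring
  rw [h, PiLp.norm_single, ← dist_eq_norm, ← dist_eq_norm]
  exact hg.dist_le_mul p q

theorem dist_horizontalShear_le (hg : LipschitzWith K g) (p q : EuclideanSpace ℝ (Fin 2)) :
    dist (horizontalShear g p) (horizontalShear g q) ≤ (1 + K) * dist p q := by
  have h₁ := norm_horizontalShear_sub_sub_le hg p q
  have h₂ := norm_le_norm_add_norm_sub' (horizontalShear g p - horizontalShear g q) (p - q)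
  rw [dist_eq_norm, dist_eq_norm]
  linarith

theorem le_dist_horizontalShear (hg : LipschitzWith K g) (p q : EuclideanSpace ℝ (Fin 2)) :
    (1 - K) * dist p q ≤ dist (horizontalShear g p) (horizontalShear g q) := by
  have h₁ := norm_horizontalShear_sub_sub_le hg p q
  have h₂ := norm_le_norm_add_norm_sub (horizontalShear g p - horizontalShear g q) (p - q)
  rw [dist_eq_norm, dist_eq_norm]
  linarith

/-- A horizontal shear along a contraction is a homeomorphism of the plane. -/
theorem exists_homeomorph_horizontalShear (hg : LipschitzWith K g) (hK : K < 1) :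
    ∃ Φ : EuclideanSpace ℝ (Fin 2) ≃ₜ EuclideanSpace ℝ (Fin 2),
      ∀ p, Φ p = horizontalShear g p := by
  have h : ApproximatesLinearOn (horizontalShear g)
      (ContinuousLinearEquiv.refl ℝ (EuclideanSpace ℝ (Fin 2)) :
        EuclideanSpace ℝ (Fin 2) →L[ℝ] EuclideanSpace ℝ (Fin 2)) univ K := by
    intro p _ q _
    exact norm_horizontalShear_sub_sub_le hg p q
  refine ⟨h.toHomeomorph _ (Or.inr ?_), fun p ↦ rfl⟩
  have h₁ : ‖((ContinuousLinearEquiv.refl ℝ (EuclideanSpace ℝ (Fin 2))).symm :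
      EuclideanSpace ℝ (Fin 2) →L[ℝ] EuclideanSpace ℝ (Fin 2))‖₊ = 1 :=
    NNReal.eq ContinuousLinearMap.norm_id
  rw [h₁]
  simpa using hK

end HorizontalShear

/-- The cosine wave of wavelength `2 * π * c`, clipped to take values in `[0, w]`. -/
noncomputable def clippedWave (w c x : ℝ) : ℝ :=
  max 0 (min w (w / 2 + w * cos (x / c)))

section ClippedWave

variable {w c x : ℝ}

theorem clippedWave_nonneg : 0 ≤ clippedWave w c x := le_max_left _ _

theorem clippedWave_le (hw : 0 ≤ w) : clippedWave w c x ≤ w := max_le hw (min_le_left _ _)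

/-- Clipping makes each crest a plateau, so a point below it stays away from the graph even after a
small horizontal error. -/
theorem clippedWave_eq_top (hw : 0 ≤ w) (h : 1 / 2 ≤ cos (x / c)) : clippedWave w c x = w := by
  have h₁ : w ≤ w / 2 + w * cos (x / c) := by nlinarith
  rw [clippedWave, min_eq_left h₁, max_eq_right hw]

theorem clippedWave_eq_zero (hw : 0 ≤ w) (h : cos (x / c) ≤ -(1 / 2)) :
    clippedWave w c x = 0 := by
  have h₁ : w / 2 + w * cos (x / c) ≤ 0 := by nlinarith
  exact max_eq_left ((min_le_right _ _).trans h₁)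

theorem abs_cos_div_sub_cos_div_le (hc : 0 < c) (x y : ℝ) :
    |cos (x / c) - cos (y / c)| ≤ |x - y| / c := by
  have h := abs_cos_sub_cos_le (x / c) (y / c)
  rwa [← sub_div, abs_div, abs_of_pos hc] at h

theorem abs_clippedWave_sub_le (hw : 0 ≤ w) (hc : 0 < c) (x y : ℝ) :
    |clippedWave w c x - clippedWave w c y| ≤ w / c * |x - y| := by
  have h₁ := abs_max_sub_max_le_abs (min w (w / 2 + w * cos (x / c)))
    (min w (w / 2 + w * cos (y / c))) 0
  have h₂ := abs_min_sub_min_le_max w (w / 2 + w * cos (x / c)) w (w / 2 + w * cos (y / c))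
  rw [sub_self, abs_zero, max_eq_right (abs_nonneg _), add_sub_add_left_eq_sub, ← mul_sub,
    abs_mul, abs_of_nonneg hw] at h₂
  rw [clippedWave, clippedWave, max_comm 0, max_comm 0]
  calc _ ≤ _ := h₁.trans h₂
    _ ≤ w * (|x - y| / c) := mul_le_mul_of_nonneg_left (abs_cos_div_sub_cos_div_le hc x y) hw
    _ = _ := by ring

theorem continuous_clippedWave : Continuous (clippedWave w c) := by
  unfold clippedWave
  fun_prop

end ClippedWave

theorem exists_abs_sub_le_pi_cos_eq_one (u : ℝ) : ∃ θ : ℝ, |θ - u| ≤ π ∧ cos θ = 1 := by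
  refine ⟨round (u / (2 * π)) * (2 * π), ?_, cos_int_mul_two_pi _⟩
  have hπ := pi_pos
  have h := abs_sub_round (u / (2 * π))
  have h₁ : (round (u / (2 * π)) : ℝ) * (2 * π) - u =
      -((u / (2 * π) - round (u / (2 * π))) * (2 * π)) := by
    field_simp
    ring
  rw [h₁, abs_neg, abs_mul, abs_of_pos (by positivity : 0 < 2 * π)]
  nlinarith

theorem exists_abs_sub_le_pi_cos_eq_neg_one (u : ℝ) : ∃ θ : ℝ, |θ - u| ≤ π ∧ cos θ = -1 := by
  obtain ⟨θ, h, hθ⟩ := exists_abs_sub_le_pi_cos_eq_one (u + π)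
  refine ⟨θ - π, ?_, by rw [cos_sub_pi, hθ]⟩
  rwa [sub_sub, add_comm π]

/-- Points of a separated set can be moved horizontally, by a bounded Lipschitz displacement,
to crests (for points of `Y`) or troughs (for the other points) of a cosine wave. -/
theorem exists_lipschitz_displacement {c s R : ℝ} {K : ℝ≥0} (hc : 0 < c) (hR : π * c ≤ R)
    (hK : 2 * R ≤ K * s) {X : Set (EuclideanSpace ℝ (Fin 2))} (hX : IsSeparatedBy s X)
    (Y : Set (EuclideanSpace ℝ (Fin 2))) :
    ∃ g : EuclideanSpace ℝ (Fin 2) → ℝ, LipschitzWith K g ∧ (∀ p, |g p| ≤ R) ∧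
      ∀ p ∈ X, (p ∈ Y → cos ((p 0 + g p) / c) = 1) ∧
        (p ∉ Y → cos ((p 0 + g p) / c) = -1) := by
  have key : ∀ p : EuclideanSpace ℝ (Fin 2), ∃ d : ℝ, |d| ≤ R ∧
      (p ∈ Y → cos ((p 0 + d) / c) = 1) ∧ (p ∉ Y → cos ((p 0 + d) / c) = -1) := by
    intro p
    have aux : ∀ θ : ℝ, |θ - p 0 / c| ≤ π →
        |c * θ - p 0| ≤ R ∧ (p 0 + (c * θ - p 0)) / c = θ := by
      intro θ hθ
      have h : c * θ - p 0 = (θ - p 0 / c) * c := by field_simp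
      refine ⟨?_, by field_simp; ring⟩
      rw [h, abs_mul, abs_of_pos hc]
      exact (mul_le_mul_of_nonneg_right hθ hc.le).trans hR
    by_cases hp : p ∈ Y
    · obtain ⟨θ, hθ, hcos⟩ := exists_abs_sub_le_pi_cos_eq_one (p 0 / c)
      exact ⟨_, (aux θ hθ).1, fun _ ↦ by rw [(aux θ hθ).2, hcos], fun h ↦ absurd hp h⟩
    · obtain ⟨θ, hθ, hcos⟩ := exists_abs_sub_le_pi_cos_eq_neg_one (p 0 / c)
      exact ⟨_, (aux θ hθ).1, fun h ↦ absurd h hp, fun _ ↦ by rw [(aux θ hθ).2, hcos]⟩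
  choose d hdR hdY hdn using key
  have hR₀ : 0 ≤ R := (by positivity : 0 ≤ π * c).trans hR
  -- Two displacements differ by at most `2 * R`, while distinct points of `X` are at least `s`
  -- apart.
  have hd : LipschitzOnWith K d X := by
    refine LipschitzOnWith.of_dist_le_mul fun p hp q hq ↦ ?_
    rcases eq_or_ne p q with rfl | hpq
    · simp
    · have h₁ := mul_le_mul_of_nonneg_left (hX p hp q hq hpq) K.coe_nonneg
      have h₂ := abs_sub (d p) (d q)
      rw [Real.dist_eq]
      linarith [hdR p, hdR q]
  obtain ⟨g, hg, hgd⟩ := hd.extend_real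
  -- Truncating the extension restores the bound `R` everywhere and changes nothing on `X`.
  refine ⟨fun p ↦ max (-R) (min R (g p)), (hg.const_min R).const_max (-R), fun p ↦ ?_, ?_⟩
  · exact abs_le.2 ⟨le_max_left _ _, max_le (by linarith) (min_le_left _ _)⟩
  · intro p hp
    have h : max (-R) (min R (g p)) = d p := by
      rw [← hgd hp, min_eq_right (abs_le.1 (hdR p)).2, max_eq_right (abs_le.1 (hdR p)).1]
    simp only [h]
    exact ⟨hdY p, hdn p⟩

theorem mainTheorem6 (s w : ℝ) (hs0 : 0 < s) (hs1 : s < 1) (hw : 1 ≤ w)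
    (X Y : Set (EuclideanSpace ℝ (Fin 2)))
    (hXstrip : ∀ x ∈ X, x 1 ∈ Set.Icc s (w - s))
    (hXsep : IsSeparatedBy s X) (hYX : Y ⊆ X) :
    ∃ γ : ℝ → EuclideanSpace ℝ (Fin 2),
      IsBilipschitz (2 ^ 30 * w ^ 4 / s ^ 4) γ ∧
      (∀ t : ℝ, |γ t 0 - t| ≤ 24 * s / 100 ∧ 0 ≤ γ t 1 ∧ γ t 1 ≤ w) ∧
      (∀ t : ℝ, ∀ x ∈ X, 2 * s / 100 ≤ dist x (γ t)) ∧
      ∃ Wplus Wminus : Set (EuclideanSpace ℝ (Fin 2)),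
        IsComponentOf Wplus (Set.range γ)ᶜ ∧
        IsComponentOf Wminus (Set.range γ)ᶜ ∧
        Wplus ≠ Wminus ∧
        {p : EuclideanSpace ℝ (Fin 2) | w < p 1} ⊆ Wplus ∧
        {p : EuclideanSpace ℝ (Fin 2) | p 1 < 0} ⊆ Wminus ∧
        Y ⊆ Wminus ∧ X \ Y ⊆ Wplus := by
  have hw0 : 0 ≤ w := by linarith
  -- Half a wavelength is `π * c < 22 / 100 * s`, within the allowed `24 * s / 100`; doubling `22 /
  -- 100` gives the Lipschitz constant `11 / 25 < 1`.
  set c : ℝ := 7 / 100 * s with hc_def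
  have hc : 0 < c := by positivity
  have hK : ((11 / 25 : ℝ≥0) : ℝ) = 11 / 25 := by norm_num
  obtain ⟨g, hg, hgR, hgX⟩ := exists_lipschitz_displacement (R := 22 / 100 * s) (K := 11 / 25)
    hc (by rw [hc_def]; nlinarith [pi_lt_d4]) (by rw [hK]; linarith) hXsep Y
  obtain ⟨Φ, hΦ⟩ := exists_homeomorph_horizontalShear hg
    (by rw [← NNReal.coe_lt_coe, hK]; norm_num)
  set f : ℝ → ℝ := clippedWave w c with hf_def
  have hf : Continuous f := continuous_clippedWave
  set γ : ℝ → EuclideanSpace ℝ (Fin 2) := fun t ↦ Φ.symm !₂[t, f t] with hγ_def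
  have hΦγ (t : ℝ) : Φ (γ t) = !₂[t, f t] := Φ.apply_symm_apply _
  have hΦ0 (p : EuclideanSpace ℝ (Fin 2)) : Φ p 0 = p 0 + g p := by simp [hΦ]
  have hΦ1 (p : EuclideanSpace ℝ (Fin 2)) : Φ p 1 = p 1 := by simp [hΦ]
  have hγ0 (t : ℝ) : γ t 0 + g (γ t) = t := by rw [← hΦ0, hΦγ]; simp
  have hγ1 (t : ℝ) : γ t 1 = f t := by rw [← hΦ1, hΦγ]; simp
  have hΦle (p q : EuclideanSpace ℝ (Fin 2)) : dist (Φ p) (Φ q) ≤ 36 / 25 * dist p q := by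
    have h := dist_horizontalShear_le hg p q
    rw [hK] at h
    rw [hΦ, hΦ]
    linarith
  have hleΦ (p q : EuclideanSpace ℝ (Fin 2)) : 14 / 25 * dist p q ≤ dist (Φ p) (Φ q) := by
    have h := le_dist_horizontalShear hg p q
    rw [hK] at h
    rw [hΦ, hΦ]
    linarith
  have hYf {p : EuclideanSpace ℝ (Fin 2)} (hp : p ∈ Y) : cos (Φ p 0 / c) = 1 := by
    rw [hΦ0]; exact (hgX p (hYX hp)).1 hp
  have hXYf {p : EuclideanSpace ℝ (Fin 2)} (hp : p ∈ X) (hpY : p ∉ Y) :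
      cos (Φ p 0 / c) = -1 := by
    rw [hΦ0]; exact (hgX p hp).2 hpY
  refine ⟨γ, fun t u ↦ ?_, fun t ↦ ⟨?_, ?_, ?_⟩, fun t p hp ↦ ?_, ?_⟩
  · have hr : 1 ≤ w / s := (one_le_div hs0).2 (by linarith)
    -- The estimates are only linear in `w / s ≥ 1`, so the fourth power leaves ample room.
    have hr4 : w / s ≤ (w / s) ^ 4 := le_self_pow₀ hr (by norm_num)
    have hL : 2 ^ 30 * w ^ 4 / s ^ 4 = 2 ^ 30 * (w / s) ^ 4 := by rw [div_pow, mul_div_assoc]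
    rw [hL, Real.dist_eq t u]
    constructor
    · have h₁ := hleΦ (γ t) (γ u)
      have h₂ := dist_le_abs_add_abs (Φ (γ t)) (Φ (γ u))
      have h₃ := abs_clippedWave_sub_le hw0 hc t u
      have h₄ : w / c = 100 / 7 * (w / s) := by rw [hc_def]; field_simp
      rw [h₄] at h₃
      rw [hΦγ, hΦγ] at h₁ h₂
      simp only [Fin.isValue, Matrix.cons_val_zero, Matrix.cons_val_one] at h₂
      have h₅ : (1 + 100 / 7 * (w / s)) * |t - u| ≤ 14 / 25 * (2 ^ 30 * (w / s) ^ 4) * |t - u| :=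
        mul_le_mul_of_nonneg_right (by linarith) (abs_nonneg _)
      linarith
    · have h₁ := abs_apply_sub_le_dist (Φ (γ t)) (Φ (γ u)) 0
      have h₂ := hΦle (γ t) (γ u)
      rw [hΦ0, hΦ0, hγ0, hγ0] at h₁
      refine (h₁.trans h₂).trans (mul_le_mul_of_nonneg_right ?_ dist_nonneg)
      linarith
  · have h₁ := hγ0 t
    have h₂ := hgR (γ t)
    rw [show γ t 0 - t = -g (γ t) by linarith, abs_neg]
    linarith
  · rw [hγ1]; exact clippedWave_nonneg
  · rw [hγ1]; exact clippedWave_le hw0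
  -- Pulling back divides by at most `36 / 25`, and `(7 / 200) / (36 / 25) > 2 / 100`.
  · suffices h : c / 2 ≤ dist (Φ p) (Φ (γ t)) by
      have := hΦle p (γ t)
      linarith
    have h₀ := abs_apply_sub_le_dist (Φ p) (Φ (γ t)) 0
    have h₁ := abs_apply_sub_le_dist (Φ p) (Φ (γ t)) 1
    obtain ⟨hps, hpw⟩ := hXstrip p hp
    by_contra! hlt
    -- Within `c / 2` of a crest or trough the wave is still clipped, so the vertical gap is at
    -- least `s`, more than `c / 2`.
    have h₂ : |cos (Φ p 0 / c) - cos (t / c)| ≤ 1 / 2 := by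
      refine (abs_cos_div_sub_cos_div_le hc _ _).trans ?_
      rw [div_le_iff₀ hc, ← hγ0 t, ← hΦ0 (γ t)]
      linarith
    rw [hΦ1, hΦ1, hγ1] at h₁
    by_cases hpY : p ∈ Y
    · rw [hYf hpY] at h₂
      have h₃ : f t = w := clippedWave_eq_top hw0 (by linarith [(abs_le.1 h₂).2])
      linarith [neg_le_abs (p 1 - f t)]
    · rw [hXYf hp hpY] at h₂
      have h₃ : f t = 0 := clippedWave_eq_zero hw0 (by linarith [(abs_le.1 h₂).1])
      linarith [le_abs_self (p 1 - f t)]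
  · set U : Set (EuclideanSpace ℝ (Fin 2)) := {p | f (Φ p 0) < p 1} with hU_def
    set V : Set (EuclideanSpace ℝ (Fin 2)) := {p | p 1 < f (Φ p 0)} with hV_def
    have hrange : (range γ)ᶜ = U ∪ V := by
      ext p
      have h : p ∈ range γ ↔ f (Φ p 0) = p 1 := by
        constructor
        · rintro ⟨t, rfl⟩
          rw [hΦ0, hγ0, hγ1]
        · intro h
          refine ⟨Φ p 0, Φ.injective ?_⟩
          rw [hΦγ, h, ← hΦ1 p]
          ext i
          fin_cases i <;> simp
      rw [mem_compl_iff, h]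
      exact ne_iff_lt_or_gt
    have hf₀ : Continuous fun p : EuclideanSpace ℝ (Fin 2) ↦ f (Φ p 0) := by fun_prop
    have hp₁ : Continuous fun p : EuclideanSpace ℝ (Fin 2) ↦ p 1 := by fun_prop
    have hU : IsOpen U := isOpen_lt hf₀ hp₁
    have hV : IsOpen V := isOpen_lt hp₁ hf₀
    have hUV : Disjoint U V := disjoint_left.2 fun p (h : f (Φ p 0) < p 1) (h' : p 1 < f (Φ p 0)) ↦
      lt_asymm h h'
    have hUc : IsPreconnected U := by
      have h : U = Φ ⁻¹' {p | f (p 0) < p 1} := by ext p; simp [hU_def, hΦ1]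
      rw [h, Homeomorph.isPreconnected_preimage]
      exact isPreconnected_epigraph hf
    have hVc : IsPreconnected V := by
      have h : V = Φ ⁻¹' {p | p 1 < f (p 0)} := by ext p; simp [hV_def, hΦ1]
      rw [h, Homeomorph.isPreconnected_preimage]
      exact isPreconnected_hypograph hf
    have hwU : {p : EuclideanSpace ℝ (Fin 2) | w < p 1} ⊆ U := fun p hp ↦
      (clippedWave_le hw0).trans_lt hp
    have h0V : {p : EuclideanSpace ℝ (Fin 2) | p 1 < 0} ⊆ V := fun p hp ↦
      lt_of_lt_of_le hp clippedWave_nonneg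
    have hmU : !₂[0, w + 1] ∈ U := hwU (by simp)
    have hmV : !₂[0, -1] ∈ V := h0V (by simp)
    refine ⟨U, V, ⟨_, hrange.symm.subset (Or.inl hmU), ?_⟩, ⟨_, hrange.symm.subset (Or.inr hmV), ?_⟩, ?_, hwU, h0V,
      fun p hp ↦ ?_, fun p hp ↦ ?_⟩
    · exact (connectedComponentIn_eq_of_isOpen_disjoint hrange hU hV hUV hUc hmU).symm
    · exact (connectedComponentIn_eq_of_isOpen_disjoint (hrange.trans (union_comm U V))
        hV hU hUV.symm hVc hmV).symm
    · intro h
      exact disjoint_left.1 hUV hmU (h ▸ hmU)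
    · have h : f (Φ p 0) = w := clippedWave_eq_top hw0 (by rw [hYf hp]; norm_num)
      rw [hV_def, mem_ofPred_eq, h]
      linarith [(hXstrip p (hYX hp)).2]
    · have h : f (Φ p 0) = 0 := clippedWave_eq_zero hw0 (by rw [hXYf hp.1 hp.2]; norm_num)
      rw [hU_def, mem_ofPred_eq, h]
      linarith [(hXstrip p hp.1).1]
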